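/- **Setting.** Let $d\ge 1$, $\Theta=\{\eta\in\mathbb{R}^d: |\eta|=1,\ \eta_1\ge 0\}$, and let $(X_i,Y_i)$, $i\ge 1$, be i.i.d. copies of $(X,Y)\in\mathbb{R}^d\times\mathbb{R}$ with $Y=m_0(\theta_0^\top X)+\epsilon$, $\mathbb{E}(\epsilon\mid X)=0$ a.s., where $\theta_0\in\Theta$ and $m_0:\mathbb{R}\to\mathbb{R}$. Let $\chi$ be the support of $X$, $D_\theta=\{\theta^\top x: x\in\chi\}$, $D=\bigcup_{\theta\in\Theta}D_\theta$, $D_0=D_{\theta_0}$, and $D^{(r)}=\bigcup\{D_\theta:\theta\in\Theta,\ |\theta-\theta_0|\le r\}$. For $S\subset\mathbb{R}$ let $\mathcal{M}_L(S)$ be the class of functions that are convex and $L$-Lipschitz on the interval spanned by $S$ (its convex hull). For a function $m$ of this kind, $m'$ denotes the right derivative. Write $\|g\|_S=\sup_{t\in S}|g(t)|$. **Assumptions.** * (A0) $\theta_{0,1}>0$, and for some $d_1\in\{1,\dots,d\}$ the coordinates $X_1,\dots,X_{d_1}$ are continuous (they have a joint Lebesgue density) and $X_{d_1+1},\dots,X_d$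 are discrete. For each $\theta\in\Theta$ there are a nonempty open interval $\mathcal{I}$ and vectors $c_0,\dots,c_{d-d_1}\in\mathbb{R}^{d-d_1}$ such that $c_l-c_0$, $1\le l\le d-d_1$, are linearly independent and $\mathcal{I}\subset\bigcap_{l=0}^{d-d_1}\{\theta^\top x: x\in\chi,\ (x_{d_1+1},\dots,x_d)=c_l\}$. * (A1) $\chi$ is compact, with $\sup_{x\in\chi}|x|\le T$ for some $T$. * (A2) There is $K_1>0$ with $K_1\,\mathbb{E}[\exp(\epsilon^2/K_1)-1\mid X]\le 1$ a.s. * (A3) $\mathbb{E}[XX^\top\{m_0'(\theta_0^\top X)\}^2]$ is nonsingular. * (A4) $\mathrm{Var}(X)$ is positive definite. * (L1) For some $r>0$, $m_0\in\mathcal{M}_{L_0}(D^{(r)})$ and $|m_0|\le M_0$ on $D^{(r)}$, for a constant $M_0\ge 1$. (For $r\ge 2$ one has $D^{(r)}=D$.) Let $L\ge L_0$, and for each $n\ge1$ let $(\check m_n,\check\theta_n)$ be, almost surely, a minimizer of $$Q_n(m,\theta)=\frac1n\sum_{i=1}^n\{Y_i-m(\theta^\top X_i)\}^2\qquad\text{over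 }(m,\theta)\in\mathcal{M}_L(D)\times\Theta .$$ **Theorem.** As $n\to\infty$, $$|\check\theta_n-\theta_0|=o_p(1),\qquad \|\check m_n-m_0\|_{D_0}=o_p(1),$$ and, for every compact subset $C$ of the interior of $D_0$ such that $m_0$ is differentiable at every point of $C$, $$\|\check m_n'-m_0'\|_C=o_p(1).$$ In particular the last statement holds for every compact $C$ in the interior of $D_0$ if $m_0$ is differentiable there. (Here $o_p$ is meant in outer probability, so no measurability of the estimators is assumed.) -/

import Mathlib

open MeasureTheory ProbabilityTheory Filter Topology Set
open scoped ENNReal NNReal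

noncomputable section

namespace SingleIndex

/-- The parameter space `Θ = {η ∈ ℝᵈ : |η| = 1, η₁ ≥ 0}` (the first coordinate has index `0`). -/
def Theta (d : ℕ) [NeZero d] : Set (EuclideanSpace ℝ (Fin d)) :=
  {η | ‖η‖ = 1 ∧ 0 ≤ η 0}

/-- `D_θ = {θᵀx : x ∈ χ}`. -/
def indexRange {d : ℕ} (χ : Set (EuclideanSpace ℝ (Fin d))) (θ : EuclideanSpace ℝ (Fin d)) :
    Set ℝ :=
  (fun x => inner ℝ θ x) '' χ

/-- `D = {θᵀx : x ∈ χ, θ ∈ Θ}`. -/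
def fullRange {d : ℕ} [NeZero d] (χ : Set (EuclideanSpace ℝ (Fin d))) : Set ℝ :=
  ⋃ θ ∈ Theta d, indexRange χ θ

/-- `D⁽ʳ⁾ = ⋃ D_θ` over `θ ∈ Θ` with `|θ - θ₀| ≤ r`. -/
def localRange {d : ℕ} [NeZero d] (χ : Set (EuclideanSpace ℝ (Fin d)))
    (θ₀ : EuclideanSpace ℝ (Fin d)) (r : ℝ) : Set ℝ :=
  ⋃ θ ∈ {η ∈ Theta d | ‖η - θ₀‖ ≤ r}, indexRange χ θ

/-- The class of convex `L`-Lipschitz functions on a set `S` of reals. Functions are total on `ℝ`,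
but only their values on the interval spanned by `S` are constrained. -/
def convexLipschitz (S : Set ℝ) (L : ℝ≥0) : Set (ℝ → ℝ) :=
  {m | ConvexOn ℝ (convexHull ℝ S) m ∧ LipschitzOnWith L m (convexHull ℝ S)}

/-- The right derivative. -/
def rightDeriv (m : ℝ → ℝ) (t : ℝ) : ℝ := derivWithin m (Ioi t) t

/-- `Q_n(m, θ) = n⁻¹ ∑_{i < n} (y_i - m(θᵀx_i))²`. -/
def leastSquares {d : ℕ} (x : ℕ → EuclideanSpace ℝ (Fin d)) (y : ℕ → ℝ) (n : ℕ)
    (m : ℝ → ℝ) (θ : EuclideanSpace ℝ (Fin d)) : ℝ :=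
  (1 / (n : ℝ)) * ∑ i ∈ Finset.range n, (y i - m (inner ℝ θ (x i))) ^ 2

/-- `(m, θ)` is a Lipschitz constrained least squares estimate from the first `n` data points:
a minimizer of `Q_n` over `M_L × Θ`. -/
def IsLLSE {d : ℕ} [NeZero d] (χ : Set (EuclideanSpace ℝ (Fin d))) (L : ℝ≥0)
    (x : ℕ → EuclideanSpace ℝ (Fin d)) (y : ℕ → ℝ) (n : ℕ)
    (m : ℝ → ℝ) (θ : EuclideanSpace ℝ (Fin d)) : Prop :=
  m ∈ convexLipschitz (fullRange χ) L ∧ θ ∈ Theta d ∧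
    ∀ m' ∈ convexLipschitz (fullRange χ) L, ∀ θ' ∈ Theta d,
      leastSquares x y n m θ ≤ leastSquares x y n m' θ'

/-- `‖g‖_S = sup_{t ∈ S} |g(t)|`, as an extended nonnegative number. -/
def supNormOn (S : Set ℝ) (g : ℝ → ℝ) : ℝ≥0∞ := ⨆ t ∈ S, ‖g t‖ₑ

/-- `Z_n = o_p(1)`. No measurability of `Z_n` is required; `μ` is applied as an outer measure. -/
def IsLittleOpOne {Ω : Type*} [MeasurableSpace Ω] (μ : Measure Ω) (Z : ℕ → Ω → ℝ≥0∞) : Prop :=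
  ∀ ε : ℝ≥0∞, 0 < ε → Tendsto (fun n => μ {ω | ε ≤ Z n ω}) atTop (𝓝 0)

section Model

variable {Ω : Type*} [MeasurableSpace Ω] {d : ℕ}

/-- The support `χ` of the distribution of `X`. -/
def covariateSupport (μ : Measure Ω) (X : Ω → EuclideanSpace ℝ (Fin d)) :
    Set (EuclideanSpace ℝ (Fin d)) :=
  (μ.map X).support

/-- The error `ε = Y - m₀(θ₀ᵀX)`. -/
def modelError (X : Ω → EuclideanSpace ℝ (Fin d)) (Y : Ω → ℝ) (m₀ : ℝ → ℝ)
    (θ₀ : EuclideanSpace ℝ (Fin d)) (ω : Ω) : ℝ :=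
  Y ω - m₀ (inner ℝ θ₀ (X ω))

/-- The pairs `(X_i, Y_i)` are i.i.d. -/
structure IsIIDSample (μ : Measure Ω) (X : ℕ → Ω → EuclideanSpace ℝ (Fin d))
    (Y : ℕ → Ω → ℝ) : Prop where
  measurable_X : ∀ i, Measurable (X i)
  measurable_Y : ∀ i, Measurable (Y i)
  indep : iIndepFun (fun i ω => (X i ω, Y i ω)) μ
  identDistrib : ∀ i, IdentDistrib (fun ω => (X i ω, Y i ω)) (fun ω => (X 0 ω, Y 0 ω)) μ μ

/-- The identifiability assumption: `θ₀` has positive first coordinate; for some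
`1 ≤ d₁ ≤ d` the first `d₁` coordinates of `X` are continuous (they have a joint Lebesgue density)
and the others are discrete; and for each `θ ∈ Θ` some nonempty open interval is contained in the
ranges of `θᵀx` over the slices `{x ∈ χ : (x_{d₁+1}, …, x_d) = c_l}`, `l = 0, …, d - d₁`, for some
`c_l` such that the vectors `c_l - c_0`, `l = 1, …, d - d₁`, are linearly independent. -/
def Identifiable [NeZero d] (μ : Measure Ω) (X : Ω → EuclideanSpace ℝ (Fin d))
    (θ₀ : EuclideanSpace ℝ (Fin d)) : Prop :=
  0 < θ₀ 0 ∧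
  ∃ d₁ : ℕ, 1 ≤ d₁ ∧ d₁ ≤ d ∧
    μ.map (fun ω (i : {i : Fin d // i.val < d₁}) => X ω i) ≪ volume ∧
    (∃ S : Set ({i : Fin d // d₁ ≤ i.val} → ℝ), S.Countable ∧
      ∀ᵐ ω ∂μ, (fun i : {i : Fin d // d₁ ≤ i.val} => X ω i) ∈ S) ∧
    ∀ θ ∈ Theta d, ∃ (a b : ℝ) (c : Fin (d - d₁ + 1) → ({i : Fin d // d₁ ≤ i.val} → ℝ)),
      a < b ∧
      LinearIndependent ℝ (fun l : Fin (d - d₁) => c l.succ - c 0) ∧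
      ∀ l, Ioo a b ⊆ indexRange
        {x ∈ covariateSupport μ X | (fun i : {i : Fin d // d₁ ≤ i.val} => x i) = c l} θ

/-- The support of `X` is compact (and so contained in a ball of some radius `T`). -/
def CompactlySupported (μ : Measure Ω) (X : Ω → EuclideanSpace ℝ (Fin d)) : Prop :=
  IsCompact (covariateSupport μ X) ∧ ∃ T : ℝ, ∀ x ∈ covariateSupport μ X, ‖x‖ ≤ T

/-- The error is conditionally centred, `E(ε | X) = 0`, and uniformly sub-Gaussian: for some
`K₁ > 0`, `K₁ E[exp(ε² / K₁) - 1 | X] ≤ 1` almost surely. -/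
def SubGaussianError (μ : Measure Ω) (X : Ω → EuclideanSpace ℝ (Fin d)) (err : Ω → ℝ) : Prop :=
  Integrable err μ ∧
  (μ[err | MeasurableSpace.comap X inferInstance] =ᵐ[μ] 0) ∧
  ∃ K₁ : ℝ, 0 < K₁ ∧ Integrable (fun ω => Real.exp (err ω ^ 2 / K₁)) μ ∧
    ∀ᵐ ω ∂μ,
      K₁ * (μ[fun ω' => Real.exp (err ω' ^ 2 / K₁) - 1 |
        MeasurableSpace.comap X inferInstance]) ω ≤ 1

/-- The matrix `E[X Xᵀ {m₀'(θ₀ᵀX)}²]`. -/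
def informationMatrix (μ : Measure Ω) (X : Ω → EuclideanSpace ℝ (Fin d)) (m₀ : ℝ → ℝ)
    (θ₀ : EuclideanSpace ℝ (Fin d)) : Matrix (Fin d) (Fin d) ℝ :=
  Matrix.of fun i j => ∫ ω, X ω i * X ω j * rightDeriv m₀ (inner ℝ θ₀ (X ω)) ^ 2 ∂μ

/-- The matrix `Var(X)`. -/
def varianceMatrix (μ : Measure Ω) (X : Ω → EuclideanSpace ℝ (Fin d)) :
    Matrix (Fin d) (Fin d) ℝ :=
  Matrix.of fun i j => covariance (fun ω => X ω i) (fun ω => X ω j) μ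

end Model

end SingleIndex

end

/-!
Consistency of the Lipschitz constrained convex least squares estimate in the single index model.

*Reduction to functions on the line.* A convex `L`-Lipschitz function on a compact interval extends
to a convex `L`-Lipschitz function on `ℝ` (`exists_convex_lipschitz_extension`), so the truth and
the estimates may be taken in one class of functions on `ℝ`. Comparison with the zero function
bounds the estimate at the origin by the second moment of the responses
(`abs_apply_zero_le_of_leastSquares_le`), so that with probability tending to one the estimates lie
in `Θ × boundedClass L B`, which is compact for the topology of pointwise convergence by Tychonoff's
theorem. On this set pointwise convergence is locally uniform, by the common Lipschitz constant.

*Identifiability.* The interval condition, which is required for every `θ ∈ Θ`, fails for `θ` a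
basis vector of a discrete coordinate. Hence `d₁ = d`, and `X` has a density on `ℝᵈ`
(`Identifiable.map_absolutelyContinuous`). Suppose that `m (θᵀx) = m₀ (θ₀ᵀx)` on the support with
`θ ≠ θ₀`. On a line in a direction orthogonal to `θ` but not to `θ₀` the left side is constant, and
a convex function takes a value other than its minimum at most twice; by Fubini's theorem
`m₀ (θ₀ᵀX)` is almost surely equal to its minimum. Then `m₀` is constant on the interval spanned by
`D_{θ₀}` and the information matrix vanishes, a contradiction (`eq_of_comp_inner_eq`).

*Consistency.* The estimate fits at least as well as the truth. Near a parameter whose regression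
function differs from the true one, the law of large numbers for a single integrable function rules
this out with probability tending to one (`exists_tendsto_measure_leastSquares_le`); compactness
leaves only parameters near the truth (`tendsto_measure_exists_far`). Since the estimates need not
be measurable, almost sure convergence would not imply convergence in outer probability. The
argument therefore bounds the event that an estimate is far from the truth by events that do not
involve the estimates.

*Derivatives.* The right derivative of a convex function lies between difference quotients over
neighbouring intervals, so uniform closeness of convex functions implies closeness of the right
derivatives on compact sets of interior points at which the limit is differentiable
(`exists_forall_abs_rightDeriv_sub_lt`).
-/

namespace SingleIndex

/-! ### Convex Lipschitz functions of one variable -/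

theorem convexHull_eq_Icc_of_isCompact {S : Set ℝ} (hS : IsCompact S) (hne : S.Nonempty) :
    convexHull ℝ S = Icc (sInf S) (sSup S) := by
  refine Subset.antisymm (convexHull_min (fun x hx => ?_) (convex_Icc _ _)) ?_
  · exact ⟨csInf_le hS.bddBelow hx, le_csSup hS.bddAbove hx⟩
  · exact (convex_convexHull ℝ S).ordConnected.out (subset_convexHull ℝ S (hS.sInf_mem hne))
      (subset_convexHull ℝ S (hS.sSup_mem hne))

/-- A convex `L`-Lipschitz function `f` on a compact interval is the restriction of a convex
`L`-Lipschitz function on the line. The extension is the infimal convolution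
`t ↦ min_s (f s + L |t - s|)`, whose minimum is attained at the projection of `t`. -/
theorem exists_convex_lipschitz_extension {a b : ℝ} (hab : a ≤ b) {L : ℝ≥0} {f : ℝ → ℝ}
    (hc : ConvexOn ℝ (Icc a b) f) (hl : LipschitzOnWith L f (Icc a b)) :
    ∃ g : ℝ → ℝ, ConvexOn ℝ univ g ∧ LipschitzWith L g ∧ EqOn g f (Icc a b) := by
  set p : ℝ → ℝ := fun t => projIcc a b hab t with hp
  have hpm : ∀ t, p t ∈ Icc a b := fun t => (projIcc a b hab t).2
  have hpid : ∀ t ∈ Icc a b, p t = t := fun t ht => by simp [hp, projIcc_of_mem hab ht]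
  have habs : ∀ t, ∀ s ∈ Icc a b, |s - p t| + |t - p t| = |t - s| := by
    intro t s hs
    rcases le_total t a with h | h
    · have : p t = a := by simp [hp, projIcc_of_le_left hab h]
      rw [this, abs_of_nonneg (by linarith [hs.1]), abs_of_nonpos (by linarith),
        abs_of_nonpos (by linarith [hs.1])]
      ring
    rcases le_total b t with h' | h'
    · have : p t = b := by simp [hp, projIcc_of_right_le hab h']
      rw [this, abs_of_nonpos (by linarith [hs.2]), abs_of_nonneg (by linarith),
        abs_of_nonneg (by linarith [hs.2])]
      ring
    · rw [hpid t ⟨h, h'⟩, abs_sub_comm]; simp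
  have hmin : ∀ t, ∀ s ∈ Icc a b, f (p t) + L * |t - p t| ≤ f s + L * |t - s| := by
    intro t s hs
    have h1 := hl.dist_le_mul _ (hpm t) _ hs
    rw [Real.dist_eq, Real.dist_eq, abs_sub_comm (p t)] at h1
    rw [← habs t s hs, mul_add]
    linarith [le_abs_self (f (p t) - f s)]
  refine ⟨fun t => f (p t) + L * |t - p t|, ⟨convex_univ, ?_⟩, ?_, ?_⟩
  · intro x _ y _ u v hu hv huv
    have h1 := hmin (u * x + v * y) (u * p x + v * p y)
      ((convex_Icc a b) (hpm x) (hpm y) hu hv huv)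
    have h2 := hc.2 (hpm x) (hpm y) hu hv huv
    have h3 : |u * x + v * y - (u * p x + v * p y)| ≤ u * |x - p x| + v * |y - p y| := by
      calc |u * x + v * y - (u * p x + v * p y)| = |u * (x - p x) + v * (y - p y)| := by
            congr 1; ring
        _ ≤ _ := by
            refine (abs_add_le _ _).trans_eq ?_
            rw [abs_mul, abs_mul, abs_of_nonneg hu, abs_of_nonneg hv]
    have h4 := mul_le_mul_of_nonneg_left h3 L.coe_nonneg
    simp only [smul_eq_mul] at h2 ⊢
    linarith
  · refine LipschitzWith.of_le_add_mul L fun x y => ?_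
    have h1 := hmin x (p y) (hpm y)
    have h2 : |x - p y| ≤ |y - p y| + dist x y := by
      rw [Real.dist_eq]
      calc |x - p y| = |(y - p y) + (x - y)| := by congr 1; ring
        _ ≤ _ := abs_add_le _ _
    have h4 := mul_le_mul_of_nonneg_left h2 L.coe_nonneg
    linarith
  · intro t ht
    simp [hpid t ht]

/-- A convex function takes a value that is not its minimum at most twice. -/
theorem finite_setOf_convexOn_eq {f : ℝ → ℝ} (hf : ConvexOn ℝ univ f) {k z : ℝ} (hz : f z < k) :
    {t | f t = k}.Finite := by
  -- strictly between `z` and a point of level `k`, the function is below `k`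
  have key : ∀ t u, f t = k → f u = k → (z < t ∧ t < u ∨ u < t ∧ t < z) → False := by
    intro t u ht hu h
    have hseg : t ∈ openSegment ℝ z u := by
      rcases h with ⟨h1, h2⟩ | ⟨h1, h2⟩
      · rw [openSegment_eq_Ioo (h1.trans h2)]; exact ⟨h1, h2⟩
      · rw [openSegment_symm, openSegment_eq_Ioo (h1.trans h2)]; exact ⟨h1, h2⟩
    obtain ⟨p, q, hp, hq, hpq, rfl⟩ := hseg
    have := hf.2 (mem_univ z) (mem_univ u) hp.le hq.le hpq
    rw [ht, hu, smul_eq_mul, smul_eq_mul] at this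
    have h3 : k = p * k + q * k := by rw [← add_mul, hpq, one_mul]
    nlinarith
  have hsub : {t | f t = k} ⊆ {t | z < t ∧ f t = k} ∪ {t | t < z ∧ f t = k} := by
    intro t ht
    rcases lt_trichotomy z t with h | h | h
    · exact Or.inl ⟨h, ht⟩
    · subst h; exact absurd ht hz.ne
    · exact Or.inr ⟨h, ht⟩
  refine Set.Finite.subset (Set.Finite.union ?_ ?_) hsub
  · refine Set.Subsingleton.finite fun t ht u hu => ?_
    rcases lt_trichotomy t u with h | h | h
    · exact (key t u ht.2 hu.2 (Or.inl ⟨ht.1, h⟩)).elim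
    · exact h
    · exact (key u t hu.2 ht.2 (Or.inl ⟨hu.1, h⟩)).elim
  · refine Set.Subsingleton.finite fun t ht u hu => ?_
    rcases lt_trichotomy t u with h | h | h
    · exact (key u t hu.2 ht.2 (Or.inr ⟨h, hu.1⟩)).elim
    · exact h
    · exact (key t u ht.2 hu.2 (Or.inr ⟨h, ht.1⟩)).elim

/-- On a neighbourhood of `t₀` the right derivative of a convex `m` lies between the slopes of `m`
over `[t₀ - 2h, t₀ - h]` and `[t₀ + h, t₀ + 2h]`. Both are close to `f' t₀` when `h` is small and
`m` is close to `f`. -/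
theorem eventually_abs_rightDeriv_sub_deriv_lt {f : ℝ → ℝ} {t₀ : ℝ} (hf : DifferentiableAt ℝ f t₀)
    {S H : Set ℝ} (hS : S ∈ 𝓝 t₀) (hSH : S ⊆ H) {ε : ℝ} (hε : 0 < ε) :
    ∃ δ > 0, ∀ᶠ t in 𝓝 t₀, ∀ m : ℝ → ℝ, ConvexOn ℝ H m → (∀ u ∈ S, |m u - f u| < δ) →
      |rightDeriv m t - deriv f t₀| < ε := by
  set s := deriv f t₀ with hs
  have h1 := (hasDerivAt_iff_isLittleO.1 hf.hasDerivAt).def (c := ε / 8) (by positivity)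
  obtain ⟨ρ, hρ, hball⟩ := Metric.eventually_nhds_iff_ball.1 (h1.and hS)
  set h := ρ / 4 with hh
  have hh0 : 0 < h := by positivity
  have hmem : ∀ u, |u - t₀| ≤ 2 * h → u ∈ S ∧ |f u - f t₀ - (u - t₀) * s| ≤ ε / 8 * |u - t₀| := by
    intro u hu
    have := hball u (by rw [Metric.mem_ball, Real.dist_eq]; linarith)
    refine ⟨this.2, ?_⟩
    simpa [hs] using this.1
  have e1 := hmem (t₀ + h) (by rw [abs_le]; constructor <;> linarith)
  have e2 := hmem (t₀ + 2 * h) (by rw [abs_le]; constructor <;> linarith)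
  have e3 := hmem (t₀ - h) (by rw [abs_le]; constructor <;> linarith)
  have e4 := hmem (t₀ - 2 * h) (by rw [abs_le]; constructor <;> linarith)
  have a1 : |t₀ + h - t₀| = h := by rw [add_sub_cancel_left, abs_of_pos hh0]
  have a2 : |t₀ + 2 * h - t₀| = 2 * h := by rw [add_sub_cancel_left, abs_of_pos (by positivity)]
  have a3 : |t₀ - h - t₀| = h := by
    rw [abs_of_nonpos (by linarith)]; ring
  have a4 : |t₀ - 2 * h - t₀| = 2 * h := by
    rw [abs_of_nonpos (by linarith)]; ring
  rw [a1] at e1; rw [a2] at e2; rw [a3] at e3; rw [a4] at e4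
  refine ⟨ε * h / 8, by positivity, ?_⟩
  filter_upwards [Metric.ball_mem_nhds t₀ hh0] with t ht m hm hclose
  rw [Metric.mem_ball, Real.dist_eq, abs_lt] at ht
  have htH : t ∈ interior H := by
    rw [mem_interior_iff_mem_nhds]
    refine Filter.mem_of_superset (Metric.ball_mem_nhds t hh0) fun u hu => hSH (hmem u ?_).1
    rw [Metric.mem_ball, Real.dist_eq, abs_lt] at hu
    rw [abs_le]; constructor <;> linarith
  have c1 := abs_lt.1 (hclose _ e1.1)
  have c2 := abs_lt.1 (hclose _ e2.1)
  have c3 := abs_lt.1 (hclose _ e3.1)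
  have c4 := abs_lt.1 (hclose _ e4.1)
  have f1 := abs_le.1 e1.2
  have f2 := abs_le.1 e2.2
  have f3 := abs_le.1 e3.2
  have f4 := abs_le.1 e4.2
  have up1 := hm.rightDeriv_le_slope_of_mem_interior htH (hSH e1.1) (by linarith)
  have up2 := hm.slope_mono_adjacent (interior_subset htH) (hSH e2.1)
    (show t < t₀ + h by linarith) (show t₀ + h < t₀ + 2 * h by linarith)
  have lo1 := hm.slope_le_leftDeriv_of_mem_interior (hSH e3.1) htH (by linarith)
  have lo2 := hm.leftDeriv_le_rightDeriv_of_mem_interior htH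
  have lo3 := hm.slope_mono_adjacent (hSH e4.1) (interior_subset htH)
    (show t₀ - 2 * h < t₀ - h by linarith) (show t₀ - h < t by linarith)
  rw [slope_def_field] at up1 lo1
  have up : rightDeriv m t ≤ (m (t₀ + 2 * h) - m (t₀ + h)) / (t₀ + 2 * h - (t₀ + h)) :=
    up1.trans up2
  have lo : (m (t₀ - h) - m (t₀ - 2 * h)) / (t₀ - h - (t₀ - 2 * h)) ≤ rightDeriv m t :=
    lo3.trans (lo1.trans lo2)
  rw [show t₀ + 2 * h - (t₀ + h) = h by ring, le_div_iff₀ hh0] at up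
  rw [show t₀ - h - (t₀ - 2 * h) = h by ring, div_le_iff₀ hh0] at lo
  have hεh := mul_pos hε hh0
  rw [abs_lt]
  constructor
  · by_contra! hcon
    have := mul_le_mul_of_nonneg_right hcon hh0.le
    linarith
  · by_contra! hcon
    have := mul_le_mul_of_nonneg_right hcon hh0.le
    linarith

/-- Uniform convergence of convex functions to a convex function that is differentiable on a
compact set of interior points forces uniform convergence of the right derivatives there. -/
theorem exists_forall_abs_rightDeriv_sub_lt {f : ℝ → ℝ} {D H C : Set ℝ} (hDH : D ⊆ H)
    (hfc : ConvexOn ℝ H f) (hC : IsCompact C) (hCD : C ⊆ interior D)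
    (hf : ∀ t ∈ C, DifferentiableAt ℝ f t) {ε : ℝ} (hε : 0 < ε) :
    ∃ δ > 0, ∀ m : ℝ → ℝ, ConvexOn ℝ H m → (∀ u ∈ D, |m u - f u| < δ) →
      ∀ t ∈ C, |rightDeriv m t - rightDeriv f t| < ε := by
  refine hC.induction_on (p := fun C => ∃ δ > 0, ∀ m : ℝ → ℝ, ConvexOn ℝ H m →
    (∀ u ∈ D, |m u - f u| < δ) → ∀ t ∈ C, |rightDeriv m t - rightDeriv f t| < ε) ?_ ?_ ?_ ?_
  · exact ⟨1, one_pos, fun m _ _ t ht => ht.elim⟩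
  · rintro s t hst ⟨δ, hδ, h⟩
    exact ⟨δ, hδ, fun m hm hu x hx => h m hm hu x (hst hx)⟩
  · rintro s t ⟨δ, hδ, h⟩ ⟨δ', hδ', h'⟩
    refine ⟨min δ δ', lt_min hδ hδ', fun m hm hu x hx => ?_⟩
    rcases hx with hx | hx
    · exact h m hm (fun u hu' => (hu u hu').trans_le (min_le_left _ _)) x hx
    · exact h' m hm (fun u hu' => (hu u hu').trans_le (min_le_right _ _)) x hx
  · intro t₀ ht₀
    obtain ⟨δ, hδ, h⟩ := eventually_abs_rightDeriv_sub_deriv_lt (hf t₀ ht₀)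
      (mem_interior_iff_mem_nhds.1 (hCD ht₀)) hDH (half_pos hε)
    refine ⟨_, mem_nhdsWithin_of_mem_nhds h, δ, hδ, fun m hm hu t ht => ?_⟩
    -- the limit function itself is one of the admissible `m`
    have h1 := abs_lt.1 (ht m hm hu)
    have h2 := abs_lt.1 (ht f hfc (fun u _ => by simpa using hδ))
    rw [abs_lt]; constructor <;> linarith

/-! ### Compactness of the parameter set -/

/-- The convex `L`-Lipschitz functions on the line with `|m 0| ≤ B`. -/
def boundedClass (L : ℝ≥0) (B : ℝ) : Set (ℝ → ℝ) :=
  {m | ConvexOn ℝ univ m ∧ LipschitzWith L m ∧ |m 0| ≤ B}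

/-- Compactness is meant in the topology of pointwise convergence. -/
theorem isCompact_boundedClass (L : ℝ≥0) (B : ℝ) : IsCompact (boundedClass L B) := by
  have hK : IsCompact (Set.pi univ fun t : ℝ => Icc (-(B + L * |t|)) (B + L * |t|)) :=
    isCompact_univ_pi fun _ => isCompact_Icc
  refine hK.of_isClosed_subset ?_ ?_
  · have : boundedClass L B =
        (⋂ (x : ℝ) (y : ℝ) (u : ℝ) (v : ℝ) (_ : 0 ≤ u) (_ : 0 ≤ v) (_ : u + v = 1),
          {m : ℝ → ℝ | m (u * x + v * y) ≤ u * m x + v * m y}) ∩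
        ((⋂ (x : ℝ) (y : ℝ), {m : ℝ → ℝ | dist (m x) (m y) ≤ L * dist x y}) ∩
          {m : ℝ → ℝ | |m 0| ≤ B}) := by
      ext m
      simp only [boundedClass, ConvexOn, lipschitzWith_iff_dist_le_mul, convex_univ, mem_univ,
        mem_ofPred_eq, mem_inter_iff, mem_iInter, true_and, forall_true_left, smul_eq_mul]
    rw [this]
    refine IsClosed.inter ?_ (IsClosed.inter ?_ ?_)
    · refine isClosed_iInter fun x => isClosed_iInter fun y => isClosed_iInter fun u =>
        isClosed_iInter fun v => isClosed_iInter fun _ => isClosed_iInter fun _ =>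
        isClosed_iInter fun _ => ?_
      exact isClosed_le (by fun_prop) (by fun_prop)
    · refine isClosed_iInter fun x => isClosed_iInter fun y => ?_
      exact isClosed_le (by fun_prop) (by fun_prop)
    · exact isClosed_le (by fun_prop) (by fun_prop)
  · rintro m ⟨_, hl, h0⟩ t _
    have h1 := hl.dist_le_mul t 0
    rw [Real.dist_eq, Real.dist_eq, sub_zero] at h1
    rw [mem_Icc, ← abs_le]
    calc |m t| = |m 0 + (m t - m 0)| := by congr 1; ring
      _ ≤ |m 0| + |m t - m 0| := abs_add_le _ _
      _ ≤ _ := add_le_add h0 h1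

/-- Pointwise convergence of uniformly Lipschitz functions is uniform on compact sets. -/
theorem eventually_forall_abs_sub_lt {L : ℝ≥0} {F : Set (ℝ → ℝ)}
    (hF : ∀ m ∈ F, LipschitzWith L m) {m₁ : ℝ → ℝ} (h₁ : m₁ ∈ F) {K : Set ℝ} (hK : IsCompact K)
    {δ : ℝ} (hδ : 0 < δ) : ∀ᶠ m in 𝓝[F] m₁, ∀ t ∈ K, |m t - m₁ t| < δ := by
  refine hK.induction_on (p := fun K => ∀ᶠ m in 𝓝[F] m₁, ∀ t ∈ K, |m t - m₁ t| < δ)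
    (by simp) (fun s t hst h => h.mono fun m hm x hx => hm x (hst hx))
    (fun s t hs ht => ?_) fun t₀ _ => ?_
  · filter_upwards [hs, ht] with m h1 h2 x hx
    exact hx.elim (h1 x) (h2 x)
  · set ρ := δ / (3 * (L + 1)) with hρ
    have hL : (0 : ℝ) < L + 1 := by positivity
    have hρ0 : 0 < ρ := by positivity
    have hLρ : L * ρ ≤ δ / 3 := by
      rw [hρ, mul_div_assoc', div_le_div_iff₀ (by positivity) (by norm_num)]
      nlinarith
    refine ⟨Metric.ball t₀ ρ, mem_nhdsWithin_of_mem_nhds (Metric.ball_mem_nhds _ hρ0), ?_⟩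
    have hev : ∀ᶠ m in 𝓝[F] m₁, m t₀ ∈ Metric.ball (m₁ t₀) (δ / 3) :=
      ((continuous_apply t₀).continuousWithinAt (s := F) (x := m₁)).eventually_mem
        (Metric.ball_mem_nhds _ (by positivity))
    filter_upwards [hev, self_mem_nhdsWithin] with m hm hmF t ht
    have h2 := (hF m hmF).dist_le_mul t t₀
    have h3 := (hF m₁ h₁).dist_le_mul t t₀
    have h4 : L * dist t t₀ ≤ δ / 3 :=
      (mul_le_mul_of_nonneg_left (Metric.mem_ball.1 ht).le L.coe_nonneg).trans hLρ
    rw [Metric.mem_ball, Real.dist_eq, abs_lt] at hm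
    have h2' := abs_le.1 (h2.trans h4)
    have h3' := abs_le.1 (h3.trans h4)
    rw [abs_lt]; constructor <;> linarith

/-! ### Identifiability -/

section Identifiability

variable {Ω : Type*} [MeasurableSpace Ω] {μ : Measure Ω} {d : ℕ}
  {X : Ω → EuclideanSpace ℝ (Fin d)} {θ₀ : EuclideanSpace ℝ (Fin d)}

/-- Under the identifiability assumption all coordinates of the covariate are continuous. If the
coordinate with index `d₁` were discrete, the corresponding basis vector `θ` would lie in `Θ`, and
`θᵀx` would be constant on every slice on which the discrete coordinates are fixed, so that its
range could not contain an interval. -/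
theorem Identifiable.map_absolutelyContinuous [NeZero d] (h : Identifiable μ X θ₀)
    (hX : Measurable X) : μ.map X ≪ volume := by
  obtain ⟨-, d₁, h1, hd, hac, -, hI⟩ := h
  rcases hd.lt_or_eq with hlt | rfl
  · exfalso
    have hne : (0 : Fin d) ≠ ⟨d₁, hlt⟩ := by
      intro h
      have := congrArg Fin.val h
      simp at this
      omega
    have hθ : EuclideanSpace.single (⟨d₁, hlt⟩ : Fin d) (1 : ℝ) ∈ Theta d := by
      refine ⟨by simp, ?_⟩
      simp [hne]
    obtain ⟨a, b, c, hab, -, hsub⟩ := hI _ hθ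
    have hconst : ∀ t ∈ Ioo a b, t = c 0 ⟨⟨d₁, hlt⟩, le_rfl⟩ := by
      intro t ht
      obtain ⟨x, ⟨-, hx⟩, rfl⟩ := hsub 0 ht
      rw [← hx]
      simp [EuclideanSpace.inner_single_left]
    obtain ⟨t, ht⟩ := exists_between hab
    obtain ⟨u, hu⟩ := exists_between ht.2
    have := (hconst t ht).trans (hconst u ⟨ht.1.trans hu.1, hu.2⟩).symm
    exact hu.1.ne this
  · let e : {i : Fin d₁ // i.val < d₁} ≃ Fin d₁ := Equiv.subtypeUnivEquiv fun i => i.2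
    have hmp := (EuclideanSpace.volume_preserving_symm_measurableEquiv_toLp (Fin d₁)).symm.comp
      (volume_measurePreserving_piCongrLeft (fun _ : Fin d₁ => ℝ) e)
    have hW : Measurable fun ω (i : {i : Fin d₁ // i.val < d₁}) => X ω i := by fun_prop
    have hcomp : X = (⇑(MeasurableEquiv.toLp 2 (Fin d₁ → ℝ)).symm.symm ∘
        ⇑(MeasurableEquiv.piCongrLeft (fun _ : Fin d₁ => ℝ) e)) ∘
        fun ω (i : {i : Fin d₁ // i.val < d₁}) => X ω i := by
      funext ω
      ext i
      exact (Equiv.piCongrLeft_apply_apply (fun _ : Fin d₁ => ℝ) e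
        (fun i : {i : Fin d₁ // i.val < d₁} => X ω i) ⟨i, i.2⟩).symm
    rw [hcomp, ← Measure.map_map hmp.measurable hW, ← hmp.map_eq]
    exact hac.map hmp.measurable

theorem ae_inner_ne {θ : EuclideanSpace ℝ (Fin d)} (hθ : θ ≠ 0) (c : ℝ) :
    ∀ᵐ x : EuclideanSpace ℝ (Fin d), inner ℝ θ x ≠ c := by
  refine ae_mem_of_ae_add_linearMap_mem (s := {x | inner ℝ θ x ≠ c})
    (LinearMap.toSpanSingleton ℝ _ θ) volume volume ?_ fun y => ?_
  · exact (isClosed_eq (by fun_prop) continuous_const).measurableSet.compl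
  · rw [ae_iff]
    refine Set.Finite.measure_zero (Set.Subsingleton.finite fun t ht u hu => ?_) _
    simp only [LinearMap.toSpanSingleton_apply, mem_ofPred_eq, not_not, inner_add_right,
      inner_smul_right, real_inner_self_eq_norm_sq] at ht hu
    have : ‖θ‖ ^ 2 ≠ 0 := by simpa using hθ
    exact mul_right_cancel₀ this (by linarith)

/-- If `f (θ₀ᵀx)`, with `f` convex, is a function of `θᵀx` on a closed set, and `θ` and `θ₀` are not
parallel, then almost everywhere on that set it does not exceed any value of `f`. On each line in
a direction `v` orthogonal to `θ` but not to `θ₀` it is constant on the set, and a convex function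
takes a value other than its minimum at most twice. -/
theorem ae_le_of_comp_inner_eq {χ : Set (EuclideanSpace ℝ (Fin d))} (hχ : IsClosed χ)
    {θ v : EuclideanSpace ℝ (Fin d)} (hθv : inner ℝ θ v = 0) (hθ₀v : inner ℝ θ₀ v ≠ 0)
    {f m : ℝ → ℝ} (hf : ConvexOn ℝ univ f) (hfc : Continuous f)
    (h : ∀ x ∈ χ, m (inner ℝ θ x) = f (inner ℝ θ₀ x)) (z : ℝ) :
    ∀ᵐ x : EuclideanSpace ℝ (Fin d), x ∈ χ → f (inner ℝ θ₀ x) ≤ f z := by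
  have hcl : MeasurableSet {x : EuclideanSpace ℝ (Fin d) | f (inner ℝ θ₀ x) ≤ f z} :=
    (isClosed_le (by fun_prop) continuous_const).measurableSet
  refine ae_mem_of_ae_add_linearMap_mem (s := {x | x ∈ χ → f (inner ℝ θ₀ x) ≤ f z})
    (LinearMap.toSpanSingleton ℝ _ v) volume volume ?_ fun y => ?_
  · have : {x | x ∈ χ → f (inner ℝ θ₀ x) ≤ f z} = χᶜ ∪ {x | f (inner ℝ θ₀ x) ≤ f z} := by
      ext x; simp [imp_iff_not_or]
    rw [this]
    exact hχ.measurableSet.compl.union hcl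
  · rw [ae_iff]
    refine Set.Finite.measure_zero ?_ _
    by_cases hk : f z < m (inner ℝ θ y)
    · refine ((finite_setOf_convexOn_eq hf hk).preimage
        (f := fun t : ℝ => inner ℝ θ₀ y + t * inner ℝ θ₀ v) ?_).subset ?_
      · intro t _ u _ htu
        exact mul_right_cancel₀ hθ₀v (add_left_cancel htu)
      · intro t ht
        simp only [LinearMap.toSpanSingleton_apply, mem_ofPred_eq, not_forall, not_le] at ht
        obtain ⟨hmem, -⟩ := ht
        have := h _ hmem
        simp only [inner_add_right, inner_smul_right, hθv, mul_zero, add_zero] at this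
        exact this.symm
    · convert Set.finite_empty
      ext t
      simp only [LinearMap.toSpanSingleton_apply, mem_ofPred_eq, not_forall, not_le,
        mem_empty_iff_false, iff_false, not_exists, not_lt]
      intro hmem
      rw [← h _ hmem]
      simp only [inner_add_right, inner_smul_right, hθv, mul_zero, add_zero]
      exact not_lt.1 hk

theorem exists_inner_eq_zero_inner_ne_zero [NeZero d] {θ : EuclideanSpace ℝ (Fin d)}
    (hθ : θ ∈ Theta d) (hθ₀ : θ₀ ∈ Theta d) (hpos : 0 < θ₀ 0) (hne : θ ≠ θ₀) :
    ∃ v : EuclideanSpace ℝ (Fin d), inner ℝ θ v = 0 ∧ inner ℝ θ₀ v ≠ 0 := by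
  set c : ℝ := inner ℝ θ θ₀ with hc
  have h0 : inner ℝ θ (θ₀ - c • θ) = 0 := by
    rw [inner_sub_right, inner_smul_right, real_inner_self_eq_norm_sq, hθ.1, ← hc]; ring
  refine ⟨θ₀ - c • θ, h0, fun h => ?_⟩
  have hv : inner ℝ (θ₀ - c • θ) (θ₀ - c • θ) = 0 := by
    rw [inner_sub_left, inner_smul_left, h, h0]; simp
  have heq : θ₀ = c • θ := sub_eq_zero.1 (inner_self_eq_zero.1 hv)
  have hnorm : |c| = 1 := by
    have := congrArg norm heq
    rwa [norm_smul, hθ.1, hθ₀.1, mul_one, Real.norm_eq_abs, eq_comm] at this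
  have hcoord : θ₀ 0 = c * θ 0 := by
    have := congrArg (fun x : EuclideanSpace ℝ (Fin d) => x 0) heq
    simpa using this
  have hcpos : 0 < c := by
    by_contra! hle
    nlinarith [mul_nonneg (neg_nonneg.2 hle) hθ.2]
  rw [abs_of_pos hcpos] at hnorm
  rw [hnorm, one_smul] at heq
  exact hne heq.symm

theorem nonempty_covariateSupport [IsProbabilityMeasure μ] (hX : Measurable X) :
    (covariateSupport μ X).Nonempty := by
  have := Measure.isProbabilityMeasure_map (μ := μ) hX.aemeasurable
  exact Measure.nonempty_support (IsProbabilityMeasure.ne_zero _)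

theorem ae_mem_covariateSupport (hX : Measurable X) : ∀ᵐ ω ∂μ, X ω ∈ covariateSupport μ X :=
  ae_of_ae_map hX.aemeasurable Measure.support_mem_ae

theorem isCompact_indexRange {χ : Set (EuclideanSpace ℝ (Fin d))} (hχ : IsCompact χ)
    (θ : EuclideanSpace ℝ (Fin d)) : IsCompact (indexRange χ θ) :=
  hχ.image (by fun_prop)

/-- If `m₀` is constant on the interval spanned by the range of the index, then its right
derivative vanishes at the index almost surely: the only exceptional point is the right end of the
interval, which is not an atom. -/
theorem informationMatrix_eq_zero [IsProbabilityMeasure μ] (hX : Measurable X)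
    (hac : μ.map X ≪ volume) (hχ : IsCompact (covariateSupport μ X)) (hθ₀ : θ₀ ≠ 0)
    {m₀ : ℝ → ℝ} {k : ℝ}
    (h : ∀ t ∈ convexHull ℝ (indexRange (covariateSupport μ X) θ₀), m₀ t = k) :
    informationMatrix μ X m₀ θ₀ = 0 := by
  set D := indexRange (covariateSupport μ X) θ₀ with hD
  have hDc : IsCompact D := isCompact_indexRange hχ θ₀
  have hDne : D.Nonempty := (nonempty_covariateSupport hX).image _
  rw [convexHull_eq_Icc_of_isCompact hDc hDne] at h
  have hend : ∀ᵐ ω ∂μ, inner ℝ θ₀ (X ω) ≠ sSup D :=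
    ae_of_ae_map hX.aemeasurable (hac.ae_le (ae_inner_ne hθ₀ (sSup D)))
  have hderiv : ∀ᵐ ω ∂μ, rightDeriv m₀ (inner ℝ θ₀ (X ω)) = 0 := by
    filter_upwards [hend, ae_mem_covariateSupport hX] with ω h1 h2
    set t : ℝ := inner ℝ θ₀ (X ω) with ht
    have htD : t ∈ D := ⟨X ω, h2, rfl⟩
    have hlow : sInf D ≤ t := csInf_le hDc.bddBelow htD
    have hup : t < sSup D := lt_of_le_of_ne (le_csSup hDc.bddAbove htD) h1
    have hev : m₀ =ᶠ[𝓝[>] t] fun _ => k := by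
      filter_upwards [Ioo_mem_nhdsGT hup] with u hu
      exact h u ⟨hlow.trans hu.1.le, hu.2.le⟩
    rw [rightDeriv, hev.derivWithin_eq (h t ⟨hlow, hup.le⟩)]
    simp
  ext i j
  rw [informationMatrix, Matrix.of_apply, Matrix.zero_apply]
  refine integral_eq_zero_of_ae ?_
  filter_upwards [hderiv] with ω hω
  simp [hω]

/-- The index direction is identified by the regression function. -/
theorem eq_of_comp_inner_eq [NeZero d] [IsProbabilityMeasure μ] (hX : Measurable X)
    (hident : Identifiable μ X θ₀) (hχ : IsCompact (covariateSupport μ X)) (hθ₀ : θ₀ ∈ Theta d)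
    {m₀ f : ℝ → ℝ} (hinfo : IsUnit (informationMatrix μ X m₀ θ₀))
    (hf : ConvexOn ℝ univ f) (hfc : Continuous f)
    (hfm : EqOn f m₀ (convexHull ℝ (indexRange (covariateSupport μ X) θ₀)))
    {θ : EuclideanSpace ℝ (Fin d)} (hθ : θ ∈ Theta d) {m : ℝ → ℝ}
    (h : ∀ x ∈ covariateSupport μ X, m (inner ℝ θ x) = f (inner ℝ θ₀ x)) : θ = θ₀ := by
  by_contra hne
  set χ := covariateSupport μ X with hχdef
  have hac := hident.map_absolutelyContinuous hX
  have hpos : 0 < θ₀ 0 := hident.1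
  obtain ⟨v, hv, hv₀⟩ := exists_inner_eq_zero_inner_ne_zero hθ hθ₀ hpos hne
  obtain ⟨p, hp, hpmin⟩ := hχ.exists_isMinOn (nonempty_covariateSupport hX)
    (f := fun x => f (inner ℝ θ₀ x)) (by fun_prop)
  set k := f (inner ℝ θ₀ p) with hk
  have hconst : χ ⊆ {x | f (inner ℝ θ₀ x) = k} := by
    refine Measure.support_subset_of_isClosed
      (isClosed_eq (by fun_prop) continuous_const) ?_
    filter_upwards [hac.ae_le (ae_le_of_comp_inner_eq hχ.isClosed hv hv₀ hf hfc h
      (inner ℝ θ₀ p)), Measure.support_mem_ae (μ := μ.map X)] with x h1 h2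
    exact le_antisymm (h1 h2) (hpmin h2)
  have hge : ∀ z, k ≤ f z := by
    by_contra! hcon
    obtain ⟨z, hz⟩ := hcon
    obtain ⟨-, d₁, -, -, -, -, hI⟩ := hident
    obtain ⟨a, b, c, hab, -, hsub⟩ := hI θ₀ hθ₀
    refine Ioo_infinite hab ((finite_setOf_convexOn_eq hf hz).subset fun t ht => ?_)
    obtain ⟨x, hx, rfl⟩ := hsub 0 ht
    exact hconst hx.1
  have hle : convexHull ℝ (indexRange χ θ₀) ⊆ {t | t ∈ univ ∧ f t ≤ k} := by
    refine convexHull_min ?_ (hf.convex_le k)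
    rintro _ ⟨x, hx, rfl⟩
    exact ⟨mem_univ _, (hconst hx).le⟩
  have hzero : informationMatrix μ X m₀ θ₀ = 0 := by
    refine informationMatrix_eq_zero hX hac hχ (fun h0 => ?_) (k := k) fun t ht => ?_
    · simp [h0] at hpos
    · rw [← hfm ht]
      exact le_antisymm (hle ht).2 (hge t)
  rw [hzero] at hinfo
  exact not_isUnit_zero hinfo

end Identifiability

/-! ### Regression functions -/

theorem isCompact_Theta (d : ℕ) [NeZero d] : IsCompact (Theta d) := by
  refine (isCompact_sphere (0 : EuclideanSpace ℝ (Fin d)) 1).of_isClosed_subset ?_ fun η hη => ?_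
  · exact (isClosed_eq continuous_norm continuous_const).inter
      (isClosed_le continuous_const ((continuous_apply 0).comp (PiLp.continuous_ofLp 2 _)))
  · simpa using hη.1

theorem isCompact_fullRange {d : ℕ} [NeZero d] {χ : Set (EuclideanSpace ℝ (Fin d))}
    (hχ : IsCompact χ) : IsCompact (fullRange χ) := by
  have : fullRange χ = (fun p : EuclideanSpace ℝ (Fin d) × EuclideanSpace ℝ (Fin d) =>
      inner ℝ p.1 p.2) '' (Theta d ×ˢ χ) := by
    ext t
    simp only [fullRange, indexRange, mem_iUnion, mem_image, mem_prod, Prod.exists, exists_prop]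
    constructor
    · rintro ⟨θ, hθ, x, hx, rfl⟩; exact ⟨θ, x, ⟨hθ, hx⟩, rfl⟩
    · rintro ⟨θ, x, ⟨hθ, hx⟩, rfl⟩; exact ⟨θ, hθ, x, hx, rfl⟩
  rw [this]
  exact ((isCompact_Theta d).prod hχ).image (by fun_prop)

/-- The regression functions `x ↦ m (θᵀx)`, uniformly in `x ∈ χ`, depend continuously on
`(θ, m)`. -/
theorem eventually_forall_abs_comp_inner_sub_lt {d : ℕ} {χ : Set (EuclideanSpace ℝ (Fin d))}
    {T : ℝ} (hT : ∀ x ∈ χ, ‖x‖ ≤ T) {L : ℝ≥0} {F : Set (ℝ → ℝ)}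
    {A : Set (EuclideanSpace ℝ (Fin d))} (hA : ∀ η ∈ A, ‖η‖ = 1)
    (hF : ∀ m ∈ F, LipschitzWith L m) {κ₁ : EuclideanSpace ℝ (Fin d) × (ℝ → ℝ)}
    (h₁ : κ₁ ∈ A ×ˢ F) {δ : ℝ} (hδ : 0 < δ) :
    ∀ᶠ κ in 𝓝[A ×ˢ F] κ₁, ∀ x ∈ χ, |κ.2 (inner ℝ κ.1 x) - κ₁.2 (inner ℝ κ₁.1 x)| < δ := by
  obtain ⟨θ₁, m₁⟩ := κ₁
  have hfun := eventually_forall_abs_sub_lt hF h₁.2 (isCompact_Icc (a := -T) (b := T))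
    (half_pos hδ)
  have hdir : ∀ᶠ θ in 𝓝[A] θ₁, L * (‖θ - θ₁‖ * T) < δ / 2 := by
    have hc : Continuous fun θ : EuclideanSpace ℝ (Fin d) => L * (‖θ - θ₁‖ * T) := by fun_prop
    refine (hc.continuousWithinAt (s := A) (x := θ₁)).eventually_lt continuousWithinAt_const ?_
    simpa using half_pos hδ
  rw [nhdsWithin_prod_eq]
  filter_upwards [(hdir.and self_mem_nhdsWithin).prod_mk hfun] with κ hκ x hx
  obtain ⟨⟨hκ1, hκA⟩, hκ2⟩ := hκ
  have hin : |inner ℝ κ.1 x| ≤ T := by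
    calc |inner ℝ κ.1 x| ≤ ‖κ.1‖ * ‖x‖ := abs_real_inner_le_norm _ _
      _ ≤ T := by rw [hA _ hκA, one_mul]; exact hT x hx
  have h1 := abs_lt.1 (hκ2 _ (abs_le.1 hin))
  have h2 := (hF m₁ h₁.2).dist_le_mul (inner ℝ κ.1 x) (inner ℝ θ₁ x)
  rw [Real.dist_eq, Real.dist_eq, ← inner_sub_left] at h2
  have h3 : |inner ℝ (κ.1 - θ₁) x| ≤ ‖κ.1 - θ₁‖ * T :=
    (abs_real_inner_le_norm _ _).trans (mul_le_mul_of_nonneg_left (hT x hx) (norm_nonneg _))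
  have h4 := abs_le.1 (h2.trans (mul_le_mul_of_nonneg_left h3 L.coe_nonneg))
  rw [abs_lt]; constructor <;> linarith

/-! ### Moments of the model -/

section Moments

variable {Ω : Type*} [MeasurableSpace Ω] {μ : Measure Ω} {d : ℕ}

theorem exists_ae_abs_comp_le {X : Ω → EuclideanSpace ℝ (Fin d)} (hX : Measurable X)
    (hχ : IsCompact (covariateSupport μ X)) {φ : EuclideanSpace ℝ (Fin d) → ℝ}
    (hφ : Continuous φ) : ∃ C, ∀ᵐ ω ∂μ, ‖φ (X ω)‖ ≤ C := by
  obtain ⟨C, hC⟩ := hχ.exists_bound_of_continuousOn hφ.continuousOn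
  exact ⟨C, (ae_mem_covariateSupport hX).mono fun ω hω => hC _ hω⟩

theorem integrable_comp [IsFiniteMeasure μ] {X : Ω → EuclideanSpace ℝ (Fin d)} (hX : Measurable X)
    (hχ : IsCompact (covariateSupport μ X)) {φ : EuclideanSpace ℝ (Fin d) → ℝ}
    (hφ : Continuous φ) : Integrable (fun ω => φ (X ω)) μ := by
  obtain ⟨C, hC⟩ := exists_ae_abs_comp_le hX hχ hφ
  exact Integrable.of_bound (hφ.measurable.comp hX).aestronglyMeasurable C hC

theorem SubGaussianError.integrable_mul_comp {X : Ω → EuclideanSpace ℝ (Fin d)} {err : Ω → ℝ}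
    (herr : SubGaussianError μ X err) (hX : Measurable X)
    (hχ : IsCompact (covariateSupport μ X)) {φ : EuclideanSpace ℝ (Fin d) → ℝ}
    (hφ : Continuous φ) : Integrable (fun ω => φ (X ω) * err ω) μ := by
  obtain ⟨C, hC⟩ := exists_ae_abs_comp_le hX hχ hφ
  exact herr.1.bdd_mul (hφ.measurable.comp hX).aestronglyMeasurable hC

theorem SubGaussianError.integral_mul_comp [IsFiniteMeasure μ]
    {X : Ω → EuclideanSpace ℝ (Fin d)} {err : Ω → ℝ}
    (herr : SubGaussianError μ X err) (hX : Measurable X)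
    (hχ : IsCompact (covariateSupport μ X)) {φ : EuclideanSpace ℝ (Fin d) → ℝ}
    (hφ : Continuous φ) : ∫ ω, φ (X ω) * err ω ∂μ = 0 := by
  have hm : MeasurableSpace.comap X inferInstance ≤ (inferInstance : MeasurableSpace Ω) :=
    hX.comap_le
  have hφX : StronglyMeasurable[MeasurableSpace.comap X inferInstance] fun ω => φ (X ω) :=
    (hφ.measurable.comp (comap_measurable X)).stronglyMeasurable
  rw [← integral_condExp hm]
  refine integral_eq_zero_of_ae ?_
  have h1 := condExp_mul_of_stronglyMeasurable_left hφX (g := err)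
    (herr.integrable_mul_comp hX hχ hφ) herr.1
  filter_upwards [h1, herr.2.1] with ω h1 h2
  have h3 : (fun ω => φ (X ω)) * err = fun ω => φ (X ω) * err ω := rfl
  rw [h3] at h1
  rw [h1, Pi.mul_apply, h2]
  simp

theorem SubGaussianError.integrable_sq {X : Ω → EuclideanSpace ℝ (Fin d)} {err : Ω → ℝ}
    (herr : SubGaussianError μ X err) : Integrable (fun ω => err ω ^ 2) μ := by
  obtain ⟨hi, -, K, hK, hexp, -⟩ := herr
  refine (hexp.const_mul K).mono' (hi.aestronglyMeasurable.pow 2) (ae_of_all _ fun ω => ?_)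
  rw [Real.norm_eq_abs, abs_of_nonneg (sq_nonneg _)]
  have := Real.add_one_le_exp (err ω ^ 2 / K)
  calc err ω ^ 2 = K * (err ω ^ 2 / K) := by field_simp
    _ ≤ _ := mul_le_mul_of_nonneg_left (by linarith) hK.le

/-- The weak law of large numbers for the sample, as a one-sided bound. -/
theorem IsIIDSample.tendsto_measure_mean_le [IsProbabilityMeasure μ]
    {X : ℕ → Ω → EuclideanSpace ℝ (Fin d)} {Y : ℕ → Ω → ℝ} (hs : IsIIDSample μ X Y)
    {h : EuclideanSpace ℝ (Fin d) × ℝ → ℝ} (hh : Measurable h)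
    (hint : Integrable (fun ω => h (X 0 ω, Y 0 ω)) μ) {c : ℝ}
    (hc : c < ∫ ω, h (X 0 ω, Y 0 ω) ∂μ) :
    Tendsto (fun n : ℕ => μ {ω | (∑ i ∈ Finset.range n, h (X i ω, Y i ω)) / n ≤ c})
      atTop (𝓝 0) := by
  have hXY : ∀ i, Measurable fun ω => (X i ω, Y i ω) := fun i =>
    (hs.measurable_X i).prodMk (hs.measurable_Y i)
  have hind : Pairwise (Function.onFun (fun f g => f ⟂ᵢ[μ] g)
      fun i ω => h (X i ω, Y i ω)) := fun i j hij =>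
    (hs.indep.indepFun hij).comp hh hh
  have hid : ∀ i, IdentDistrib (fun ω => h (X i ω, Y i ω)) (fun ω => h (X 0 ω, Y 0 ω)) μ μ :=
    fun i => (hs.identDistrib i).comp hh
  have hlln := strong_law_ae_real (fun i ω => h (X i ω, Y i ω)) hint hind hid
  have hmeas := tendstoInMeasure_of_tendsto_ae (fun n => Measurable.aestronglyMeasurable
    (((Finset.range n).measurable_fun_sum fun i _ => hh.comp (hXY i)).div_const _)) hlln
  rw [tendstoInMeasure_iff_dist] at hmeas
  refine tendsto_of_tendsto_of_tendsto_of_le_of_le tendsto_const_nhds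
    (hmeas _ (sub_pos.2 hc)) (fun _ => zero_le) fun n => measure_mono fun ω hω => ?_
  simp only [mem_ofPred_eq, Real.dist_eq, Function.comp_apply] at hω ⊢
  rw [abs_sub_comm]
  exact le_trans (by linarith) (le_abs_self _)

end Moments

/-! ### Least squares -/

section LeastSquares

variable {d : ℕ}

/-- A Lipschitz least squares fit that does no worse than the zero function is bounded at the
origin in terms of the second moment of the responses. -/
theorem abs_apply_zero_le_of_leastSquares_le {x : ℕ → EuclideanSpace ℝ (Fin d)} {y : ℕ → ℝ}
    {n : ℕ} (hn : 1 ≤ n) {T R : ℝ} (hT : ∀ i, ‖x i‖ ≤ T)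
    (hR : (∑ i ∈ Finset.range n, y i ^ 2) / n < R) {L : ℝ≥0} {m : ℝ → ℝ} (hm : LipschitzWith L m)
    {θ : EuclideanSpace ℝ (Fin d)} (hθ : ‖θ‖ = 1)
    (h : leastSquares x y n m θ ≤ leastSquares x y n (fun _ => 0) θ) :
    |m 0| ≤ L * T + 2 * (R + 1) := by
  have hn0 : (0 : ℝ) < n := by exact_mod_cast hn
  have hR0 : 0 < R := lt_of_le_of_lt (by positivity) hR
  by_contra! hcon
  have hbig : ∀ i, 4 * (R + 1) ≤ m (inner ℝ θ (x i)) ^ 2 := by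
    intro i
    have h1 := hm.dist_le_mul 0 (inner ℝ θ (x i))
    have h2 : dist 0 (inner ℝ θ (x i)) ≤ T := by
      rw [Real.dist_eq, zero_sub, abs_neg]
      refine (abs_real_inner_le_norm _ _).trans ?_
      rw [hθ, one_mul]; exact hT i
    have h3 := h1.trans (mul_le_mul_of_nonneg_left h2 L.coe_nonneg)
    rw [Real.dist_eq] at h3
    have h4 : 2 * (R + 1) ≤ |m (inner ℝ θ (x i))| := by
      have : |m 0| ≤ |m 0 - m (inner ℝ θ (x i))| + |m (inner ℝ θ (x i))| := by
        simpa using abs_add_le (m 0 - m (inner ℝ θ (x i))) (m (inner ℝ θ (x i)))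
      linarith
    rw [← sq_abs]
    nlinarith
  have hle : ∀ i ∈ Finset.range n, 4 * (R + 1) ≤
      2 * (y i - m (inner ℝ θ (x i))) ^ 2 + 2 * y i ^ 2 := by
    intro i _
    have := hbig i
    nlinarith [sq_nonneg (y i - m (inner ℝ θ (x i)) + y i)]
  have hsum := Finset.sum_le_sum hle
  rw [Finset.sum_const, Finset.card_range, nsmul_eq_mul, Finset.sum_add_distrib, ← Finset.mul_sum,
    ← Finset.mul_sum] at hsum
  rw [leastSquares, leastSquares, mul_le_mul_iff_right₀ (by positivity)] at h
  simp only [sub_zero] at h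
  rw [div_lt_iff₀ hn0] at hR
  nlinarith

/-- The basic inequality for least squares, relaxed so that its right-hand side depends on `g`
only: `m (θᵀx)` may vary in a `δ`-neighbourhood of `g x`, uniformly over the sample. -/
theorem mean_le_of_leastSquares_le {x : ℕ → EuclideanSpace ℝ (Fin d)} {y : ℕ → ℝ}
    {n : ℕ} (hn : 1 ≤ n) {f m : ℝ → ℝ} {θ θ₀ : EuclideanSpace ℝ (Fin d)}
    {g : EuclideanSpace ℝ (Fin d) → ℝ} {δ : ℝ}
    (hg : ∀ i, |m (inner ℝ θ (x i)) - g (x i)| < δ)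
    (h : leastSquares x y n m θ ≤ leastSquares x y n f θ₀) :
    (∑ i ∈ Finset.range n, ((g (x i) - f (inner ℝ θ₀ (x i))) ^ 2 / 2
      - 2 * ((g (x i) - f (inner ℝ θ₀ (x i))) * (y i - f (inner ℝ θ₀ (x i))))
      - 2 * δ * |y i - f (inner ℝ θ₀ (x i))|)) / n ≤ δ ^ 2 := by
  have hn0 : (0 : ℝ) < n := by exact_mod_cast hn
  rw [leastSquares, leastSquares, mul_le_mul_iff_right₀ (by positivity)] at h
  rw [div_le_iff₀ hn0]
  have hle : ∀ i ∈ Finset.range n, ((g (x i) - f (inner ℝ θ₀ (x i))) ^ 2 / 2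
      - 2 * ((g (x i) - f (inner ℝ θ₀ (x i))) * (y i - f (inner ℝ θ₀ (x i))))
      - 2 * δ * |y i - f (inner ℝ θ₀ (x i))|) ≤
      (y i - m (inner ℝ θ (x i))) ^ 2 - (y i - f (inner ℝ θ₀ (x i))) ^ 2 + δ ^ 2 := by
    intro i _
    set a := f (inner ℝ θ₀ (x i))
    set b := m (inner ℝ θ (x i)) - g (x i) with hb
    have hb1 : |b| < δ := hg i
    have hm : m (inner ℝ θ (x i)) = g (x i) + b := by rw [hb]; ring
    rw [hm]
    have hb2 : b ^ 2 ≤ δ ^ 2 := by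
      rw [← sq_abs]; exact pow_le_pow_left₀ (abs_nonneg _) hb1.le 2
    have hb3 : b * (y i - a) ≤ δ * |y i - a| := by
      refine (le_abs_self _).trans ?_
      rw [abs_mul]
      exact mul_le_mul_of_nonneg_right hb1.le (abs_nonneg _)
    nlinarith [sq_nonneg ((g (x i) - a) + 2 * b)]
  refine (Finset.sum_le_sum hle).trans ?_
  rw [Finset.sum_add_distrib, Finset.sum_sub_distrib, Finset.sum_const, Finset.card_range,
    nsmul_eq_mul]
  linarith

end LeastSquares

/-! ### Consistency -/

section Consistency

variable {Ω : Type*} [MeasurableSpace Ω] {μ : Measure Ω} {d : ℕ}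

theorem SubGaussianError.congr {X : Ω → EuclideanSpace ℝ (Fin d)} {err err' : Ω → ℝ}
    (h : SubGaussianError μ X err) (he : err =ᵐ[μ] err') : SubGaussianError μ X err' := by
  obtain ⟨hi, hc, K, hK, hexp, hb⟩ := h
  refine ⟨hi.congr he, (condExp_congr_ae he.symm).trans hc, K, hK, hexp.congr ?_, ?_⟩
  · filter_upwards [he] with ω hω
    rw [hω]
  · have h1 : (fun ω => Real.exp (err ω ^ 2 / K) - 1) =ᵐ[μ]
        fun ω => Real.exp (err' ω ^ 2 / K) - 1 := by
      filter_upwards [he] with ω hω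
      rw [hω]
    filter_upwards [hb, condExp_congr_ae (m := MeasurableSpace.comap X inferInstance) h1]
      with ω h2 h3
    rwa [h3] at h2

theorem integral_sq_comp_pos [IsProbabilityMeasure μ] {X : Ω → EuclideanSpace ℝ (Fin d)}
    (hX : Measurable X) (hχ : IsCompact (covariateSupport μ X))
    {φ : EuclideanSpace ℝ (Fin d) → ℝ} (hφ : Continuous φ)
    (hne : ¬ ∀ x ∈ covariateSupport μ X, φ x = 0) : 0 < ∫ ω, φ (X ω) ^ 2 ∂μ := by
  refine lt_of_le_of_ne (integral_nonneg fun ω => sq_nonneg _) fun h0 => hne ?_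
  have h1 := (integral_eq_zero_iff_of_nonneg (fun ω => sq_nonneg (φ (X ω)))
    (integrable_comp hX hχ (hφ.pow 2))).1 h0.symm
  have hcl : IsClosed {x | φ x = 0} := isClosed_eq hφ continuous_const
  refine Measure.support_subset_of_isClosed hcl ?_
  change ∀ᵐ x ∂μ.map X, φ x = 0
  rw [ae_map_iff hX.aemeasurable hcl.measurableSet]
  filter_upwards [h1] with ω hω
  simpa using hω

/-- If the function `g` differs from the true regression function on the support of the
covariate, then with probability tending to one no fit that is uniformly close to `g` on the
support does as well as the truth. -/
theorem exists_tendsto_measure_leastSquares_le [IsProbabilityMeasure μ]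
    {X : ℕ → Ω → EuclideanSpace ℝ (Fin d)} {Y : ℕ → Ω → ℝ} (hs : IsIIDSample μ X Y)
    (hχ : IsCompact (covariateSupport μ (X 0))) {f : ℝ → ℝ} (hf : Continuous f)
    {θ₀ : EuclideanSpace ℝ (Fin d)} (herr : SubGaussianError μ (X 0) (modelError (X 0) (Y 0) f θ₀))
    {g : EuclideanSpace ℝ (Fin d) → ℝ} (hg : Continuous g)
    (hne : ¬ ∀ x ∈ covariateSupport μ (X 0), g x = f (inner ℝ θ₀ x)) :
    ∃ δ > 0, Tendsto (fun n : ℕ => μ {ω | (∀ i, X i ω ∈ covariateSupport μ (X 0)) ∧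
      ∃ κ : EuclideanSpace ℝ (Fin d) × (ℝ → ℝ),
        (∀ x ∈ covariateSupport μ (X 0), |κ.2 (inner ℝ κ.1 x) - g x| < δ) ∧
        leastSquares (fun i => X i ω) (fun i => Y i ω) n κ.2 κ.1 ≤
          leastSquares (fun i => X i ω) (fun i => Y i ω) n f θ₀}) atTop (𝓝 0) := by
  have hX := hs.measurable_X 0
  set φ : EuclideanSpace ℝ (Fin d) → ℝ := fun x => g x - f (inner ℝ θ₀ x) with hφ
  have hφc : Continuous φ := by fun_prop
  set e := modelError (X 0) (Y 0) f θ₀ with he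
  have hA : 0 < ∫ ω, φ (X 0 ω) ^ 2 ∂μ :=
    integral_sq_comp_pos hX hχ hφc fun h => hne fun x hx => sub_eq_zero.1 (h x hx)
  set A := ∫ ω, φ (X 0 ω) ^ 2 ∂μ with hAdef
  set M := ∫ ω, |e ω| ∂μ with hM
  have hM0 : 0 ≤ M := integral_nonneg fun ω => abs_nonneg _
  -- small enough that `2 δ M + δ²` stays below `A / 2`
  set δ := min 1 (A / (4 * (2 * M + 1))) with hδ
  have hδ0 : 0 < δ := lt_min one_pos (by positivity)
  have hδ1 : δ ≤ 1 := min_le_left _ _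
  have hδA : δ * (2 * M + 1) ≤ A / 4 := by
    have := min_le_right 1 (A / (4 * (2 * M + 1)))
    rw [← hδ, le_div_iff₀ (by positivity)] at this
    linarith
  refine ⟨δ, hδ0, ?_⟩
  let h : EuclideanSpace ℝ (Fin d) × ℝ → ℝ := fun p =>
    φ p.1 ^ 2 / 2 - 2 * (φ p.1 * (p.2 - f (inner ℝ θ₀ p.1)))
      - 2 * δ * |p.2 - f (inner ℝ θ₀ p.1)|
  have hh : Measurable h := Continuous.measurable (by fun_prop)
  have i1 : Integrable (fun ω => φ (X 0 ω) ^ 2 / 2) μ :=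
    (integrable_comp hX hχ (hφc.pow 2)).div_const 2
  have i2 : Integrable (fun ω => 2 * (φ (X 0 ω) * e ω)) μ :=
    (herr.integrable_mul_comp hX hχ hφc).const_mul 2
  have i3 : Integrable (fun ω => 2 * δ * |e ω|) μ := herr.1.abs.const_mul _
  have hint : Integrable (fun ω => h (X 0 ω, Y 0 ω)) μ := (i1.sub i2).sub i3
  have hEh : ∫ ω, h (X 0 ω, Y 0 ω) ∂μ = A / 2 - 2 * δ * M := by
    have : ∫ ω, h (X 0 ω, Y 0 ω) ∂μ =
        ∫ ω, (φ (X 0 ω) ^ 2 / 2 - 2 * (φ (X 0 ω) * e ω) - 2 * δ * |e ω|) ∂μ := rfl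
    rw [this, integral_sub (by exact i1.sub i2) i3, integral_sub i1 i2, integral_div,
      integral_const_mul, integral_const_mul, herr.integral_mul_comp hX hχ hφc]
    ring
  refine tendsto_of_tendsto_of_tendsto_of_le_of_le' tendsto_const_nhds
    (hs.tendsto_measure_mean_le hh hint (c := δ ^ 2) (by rw [hEh]; nlinarith))
    (Eventually.of_forall fun _ => zero_le) ?_
  filter_upwards [eventually_ge_atTop 1] with n hn
  refine measure_mono ?_
  rintro ω ⟨hω, κ, hκ, hls⟩
  exact mean_le_of_leastSquares_le hn (fun i => hκ _ (hω i)) hls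

/-- With probability tending to one, no parameter far from the truth does as well as the truth.
This is a covering argument over the compact parameter set: near a parameter that does not
reproduce the regression function the fit is too poor, and the other parameters are identified. -/
theorem tendsto_measure_exists_far [NeZero d] [IsProbabilityMeasure μ]
    {X : ℕ → Ω → EuclideanSpace ℝ (Fin d)} {Y : ℕ → Ω → ℝ} (hs : IsIIDSample μ X Y)
    (hχ : IsCompact (covariateSupport μ (X 0))) {m₀ f : ℝ → ℝ} {L : ℝ≥0}
    (hf : ConvexOn ℝ univ f) (hfL : LipschitzWith L f)
    {θ₀ : EuclideanSpace ℝ (Fin d)} (hθ₀ : θ₀ ∈ Theta d) (hident : Identifiable μ (X 0) θ₀)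
    (hinfo : IsUnit (informationMatrix μ (X 0) m₀ θ₀))
    (hfm : EqOn f m₀ (convexHull ℝ (indexRange (covariateSupport μ (X 0)) θ₀)))
    (herr : SubGaussianError μ (X 0) (modelError (X 0) (Y 0) f θ₀)) (B : ℝ) {ε : ℝ} (hε : 0 < ε) :
    Tendsto (fun n : ℕ => μ {ω | (∀ i, X i ω ∈ covariateSupport μ (X 0)) ∧
      ∃ κ ∈ Theta d ×ˢ boundedClass L B,
        (ε ≤ ‖κ.1 - θ₀‖ ∨ ∃ t ∈ indexRange (covariateSupport μ (X 0)) θ₀, ε ≤ |κ.2 t - f t|) ∧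
        leastSquares (fun i => X i ω) (fun i => Y i ω) n κ.2 κ.1 ≤
          leastSquares (fun i => X i ω) (fun i => Y i ω) n f θ₀}) atTop (𝓝 0) := by
  have hX := hs.measurable_X 0
  set χ := covariateSupport μ (X 0) with hχdef
  obtain ⟨T, hT⟩ := hχ.isBounded.exists_norm_le
  refine ((isCompact_Theta d).prod (isCompact_boundedClass L B)).induction_on
    (p := fun S => Tendsto (fun n : ℕ => μ {ω | (∀ i, X i ω ∈ χ) ∧ ∃ κ ∈ S,
        (ε ≤ ‖κ.1 - θ₀‖ ∨ ∃ t ∈ indexRange χ θ₀, ε ≤ |κ.2 t - f t|) ∧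
        leastSquares (fun i => X i ω) (fun i => Y i ω) n κ.2 κ.1 ≤
          leastSquares (fun i => X i ω) (fun i => Y i ω) n f θ₀}) atTop (𝓝 0))
    ?_ ?_ ?_ ?_
  · simp
  · intro s t hst ht
    refine tendsto_of_tendsto_of_tendsto_of_le_of_le tendsto_const_nhds ht
      (fun _ => zero_le) fun n => measure_mono ?_
    rintro ω ⟨hω, κ, hκ, h⟩
    exact ⟨hω, κ, hst hκ, h⟩
  · intro s t hs ht
    have hst := hs.add ht
    rw [add_zero] at hst
    refine tendsto_of_tendsto_of_tendsto_of_le_of_le tendsto_const_nhds hst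
      (fun _ => zero_le) fun n =>
      (measure_mono ?_).trans (measure_union_le _ _)
    rintro ω ⟨hω, κ, hκ | hκ, h⟩
    · exact Or.inl ⟨hω, κ, hκ, h⟩
    · exact Or.inr ⟨hω, κ, hκ, h⟩
  · intro κ₁ hκ₁
    have hLip : ∀ m ∈ boundedClass L B, LipschitzWith L m := fun m hm => hm.2.1
    by_cases hg : ∀ x ∈ χ, κ₁.2 (inner ℝ κ₁.1 x) = f (inner ℝ θ₀ x)
    · have hθ : κ₁.1 = θ₀ := eq_of_comp_inner_eq hX hident hχ hθ₀ hinfo hf hfL.continuous hfm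
        hκ₁.1 hg
      have hm : ∀ t ∈ indexRange χ θ₀, κ₁.2 t = f t := by
        rintro _ ⟨x, hx, rfl⟩
        have := hg x hx
        rwa [hθ] at this
      have hfst : ∀ᶠ θ in 𝓝[Theta d] κ₁.1, ‖θ - θ₀‖ < ε := by
        rw [hθ]
        have hc : Continuous fun θ : EuclideanSpace ℝ (Fin d) => ‖θ - θ₀‖ := by fun_prop
        refine (hc.continuousWithinAt (s := Theta d) (x := θ₀)).eventually_lt
          continuousWithinAt_const ?_
        simpa using hε
      have hev := hfst.prod_mk
        (eventually_forall_abs_sub_lt hLip hκ₁.2 (isCompact_indexRange hχ θ₀) hε)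
      rw [← nhdsWithin_prod_eq] at hev
      refine ⟨_, hev, ?_⟩
      -- no parameter of this neighbourhood is far from the truth
      convert tendsto_const_nhds (x := (0 : ℝ≥0∞)) using 2 with n
      convert measure_empty (μ := μ)
      ext ω
      simp only [mem_ofPred_eq, mem_empty_iff_false, iff_false]
      rintro ⟨-, κ, ⟨h1, h2⟩, h3 | ⟨t, ht, h3⟩, -⟩
      · exact h1.not_ge h3
      · have := h2 t ht
        rw [hm t ht] at this
        exact this.not_ge h3
    · have hmc : Continuous κ₁.2 := (hLip _ hκ₁.2).continuous
      obtain ⟨δ, hδ, hlim⟩ := exists_tendsto_measure_leastSquares_le hs hχ hfL.continuous herr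
        (g := fun x => κ₁.2 (inner ℝ κ₁.1 x)) (by fun_prop) hg
      refine ⟨_, eventually_forall_abs_comp_inner_sub_lt hT (fun η (hη : η ∈ Theta d) => hη.1)
        hLip hκ₁ hδ, ?_⟩
      refine tendsto_of_tendsto_of_tendsto_of_le_of_le tendsto_const_nhds hlim
        (fun _ => zero_le) fun n => measure_mono ?_
      rintro ω ⟨hω, κ, hκ, -, h⟩
      exact ⟨hω, κ, hκ, h⟩

/-- The least squares estimates are consistent for the direction and, uniformly on the range of
the true index, for the link function. The two errors are bounded on one event, without any
measurability of the estimates. -/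
theorem tendsto_measure_estimate_far [NeZero d] [IsProbabilityMeasure μ]
    {X : ℕ → Ω → EuclideanSpace ℝ (Fin d)} {Y : ℕ → Ω → ℝ} (hs : IsIIDSample μ X Y)
    (hχ : IsCompact (covariateSupport μ (X 0))) {m₀ : ℝ → ℝ} {L : ℝ≥0}
    {θ₀ : EuclideanSpace ℝ (Fin d)} (hθ₀ : θ₀ ∈ Theta d) (hident : Identifiable μ (X 0) θ₀)
    (hinfo : IsUnit (informationMatrix μ (X 0) m₀ θ₀))
    (hm₀ : m₀ ∈ convexLipschitz (indexRange (covariateSupport μ (X 0)) θ₀) L)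
    (herr : SubGaussianError μ (X 0) (modelError (X 0) (Y 0) m₀ θ₀))
    {mhat : ℕ → Ω → ℝ → ℝ} {θhat : ℕ → Ω → EuclideanSpace ℝ (Fin d)}
    (hLLSE : ∀ n, 1 ≤ n → ∀ᵐ ω ∂μ, IsLLSE (covariateSupport μ (X 0)) L
      (fun i => X i ω) (fun i => Y i ω) n (mhat n ω) (θhat n ω)) {ε : ℝ} (hε : 0 < ε) :
    Tendsto (fun n : ℕ => μ {ω | ε ≤ ‖θhat n ω - θ₀‖ ∨
      ∃ t ∈ indexRange (covariateSupport μ (X 0)) θ₀, ε ≤ |mhat n ω t - m₀ t|})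
      atTop (𝓝 0) := by
  have hX := hs.measurable_X 0
  set χ := covariateSupport μ (X 0) with hχdef
  have hne : χ.Nonempty := nonempty_covariateSupport hX
  obtain ⟨T, hT⟩ := hχ.isBounded.exists_norm_le
  have hsub : ∀ θ ∈ Theta d, indexRange χ θ ⊆ fullRange χ := fun θ hθ =>
    subset_biUnion_of_mem (u := fun θ => indexRange χ θ) hθ
  -- the truth extends to an admissible parameter
  obtain ⟨f, hf, hfL, hfm⟩ : ∃ f : ℝ → ℝ, ConvexOn ℝ univ f ∧ LipschitzWith L f ∧
      EqOn f m₀ (convexHull ℝ (indexRange χ θ₀)) := by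
    obtain ⟨h1, h2⟩ := hm₀
    have hc := isCompact_indexRange hχ θ₀
    have hn : (indexRange χ θ₀).Nonempty := hne.image _
    rw [convexHull_eq_Icc_of_isCompact hc hn] at h1 h2 ⊢
    exact exists_convex_lipschitz_extension (Real.sInf_le_sSup _ hc.bddBelow hc.bddAbove) h1 h2
  have hfD : ∀ t ∈ indexRange χ θ₀, f t = m₀ t := fun t ht => hfm (subset_convexHull ℝ _ ht)
  have herr' : SubGaussianError μ (X 0) (modelError (X 0) (Y 0) f θ₀) := by
    refine herr.congr ?_
    filter_upwards [ae_mem_covariateSupport hX] with ω hω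
    rw [modelError, modelError, hfD _ ⟨_, hω, rfl⟩]
  -- the second moment of the responses controls the estimate at the origin
  have hY2 : Integrable (fun ω => Y 0 ω ^ 2) μ := by
    have h1 : Integrable (fun ω => 2 * modelError (X 0) (Y 0) f θ₀ ω ^ 2 +
        2 * f (inner ℝ θ₀ (X 0 ω)) ^ 2) μ := by
      refine (herr'.integrable_sq.const_mul 2).add (Integrable.const_mul ?_ 2)
      exact integrable_comp hX hχ (φ := fun x => f (inner ℝ θ₀ x) ^ 2)
        (by have := hfL.continuous; fun_prop)
    refine h1.mono' ((hs.measurable_Y 0).pow_const 2).aestronglyMeasurable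
      (ae_of_all _ fun ω => ?_)
    rw [Real.norm_eq_abs, abs_of_nonneg (sq_nonneg _), modelError]
    nlinarith [sq_nonneg (Y 0 ω - f (inner ℝ θ₀ (X 0 ω)) - f (inner ℝ θ₀ (X 0 ω)))]
  set R := ∫ ω, Y 0 ω ^ 2 ∂μ + 1 with hR
  have hYlim := hs.tendsto_measure_mean_le (h := fun p => -p.2 ^ 2) (by fun_prop) hY2.neg
    (c := -R) (by rw [integral_neg]; linarith)
  have hfar := tendsto_measure_exists_far hs hχ hf hfL hθ₀ hident hinfo hfm herr'
    (L * T + 2 * (R + 1)) hε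
  have hXmem : ∀ᵐ ω ∂μ, ∀ i, X i ω ∈ χ := by
    refine ae_all_iff.2 fun i => ?_
    have hid : μ.map (X i) = μ.map (X 0) :=
      ((hs.identDistrib i).comp measurable_fst).map_eq
    have := ae_mem_covariateSupport (μ := μ) (hs.measurable_X i)
    rwa [covariateSupport, hid] at this
  have hlim := hYlim.add hfar
  rw [add_zero] at hlim
  refine tendsto_of_tendsto_of_tendsto_of_le_of_le' tendsto_const_nhds hlim
    (Eventually.of_forall fun _ => zero_le) ?_
  filter_upwards [eventually_ge_atTop 1] with n hn
  refine (measure_mono_ae ?_).trans (measure_union_le _ _)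
  filter_upwards [hLLSE n hn, hXmem] with ω hω hωX hωfar
  obtain ⟨⟨hmc, hml⟩, hθ, hmin⟩ := hω
  have hDc := isCompact_fullRange hχ
  have hDn : (fullRange χ).Nonempty := (hne.image _).mono (hsub θ₀ hθ₀)
  rw [convexHull_eq_Icc_of_isCompact hDc hDn] at hmc hml
  obtain ⟨m, hm, hmL, hmm⟩ := exists_convex_lipschitz_extension
    (Real.sInf_le_sSup _ hDc.bddBelow hDc.bddAbove) hmc hml
  rw [← convexHull_eq_Icc_of_isCompact hDc hDn] at hmm
  have hmD : ∀ θ ∈ Theta d, ∀ t ∈ indexRange χ θ, m t = mhat n ω t := fun θ hθ t ht =>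
    hmm (subset_convexHull ℝ _ (hsub θ hθ ht))
  have hls : leastSquares (fun i => X i ω) (fun i => Y i ω) n m (θhat n ω) =
      leastSquares (fun i => X i ω) (fun i => Y i ω) n (mhat n ω) (θhat n ω) := by
    simp only [leastSquares]
    congr 1
    refine Finset.sum_congr rfl fun i _ => ?_
    rw [hmD _ hθ _ ⟨_, hωX i, rfl⟩]
  -- the event on which the mean square of the responses is large is covered by the first set
  by_cases hYn : (∑ i ∈ Finset.range n, Y i ω ^ 2) / n < R
  · refine Or.inr ⟨hωX, (θhat n ω, m), ⟨hθ, hm, hmL, ?_⟩, ?_, ?_⟩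
    · refine abs_apply_zero_le_of_leastSquares_le hn (fun i => hT _ (hωX i)) hYn hmL hθ.1 ?_
      rw [hls]
      refine hmin _ ⟨convexOn_const 0 (convex_convexHull ℝ _), ?_⟩ _ hθ
      exact ((LipschitzWith.const (0 : ℝ)).weaken zero_le).lipschitzOnWith
    · refine hωfar.imp_right ?_
      rintro ⟨t, ht, h⟩
      refine ⟨t, ht, ?_⟩
      dsimp only
      rwa [hmD θ₀ hθ₀ t ht, hfD t ht]
    · dsimp only
      rw [hls]
      exact hmin f ⟨hf.subset (subset_univ _) (convex_convexHull ℝ _), hfL.lipschitzOnWith⟩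
        θ₀ hθ₀
  · refine Or.inl ?_
    change (∑ i ∈ Finset.range n, -(Y i ω) ^ 2) / n ≤ -R
    rw [Finset.sum_neg_distrib, neg_div]
    linarith [not_lt.1 hYn]

/-- To show that `Z n = o_p(1)` it suffices to bound `Z n` by any positive real, off an event of
vanishing outer probability. -/
theorem isLittleOpOne_of_forall {Z : ℕ → Ω → ℝ≥0∞}
    (h : ∀ ε : ℝ, 0 < ε → ∃ E : ℕ → Set Ω, Tendsto (fun n => μ (E n)) atTop (𝓝 0) ∧
      ∀ᶠ n in atTop, ∀ᵐ ω ∂μ, ω ∉ E n → Z n ω ≤ ENNReal.ofReal ε) : IsLittleOpOne μ Z := by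
  intro ε hε
  obtain ⟨η, hη0, hηε⟩ := ENNReal.lt_iff_exists_real_btwn.1 hε
  have hη : 0 < η := ENNReal.ofReal_pos.1 hηε.1
  obtain ⟨E, hE, hZ⟩ := h η hη
  refine tendsto_of_tendsto_of_tendsto_of_le_of_le' tendsto_const_nhds hE
    (Eventually.of_forall fun _ => zero_le) ?_
  filter_upwards [hZ] with n hn
  refine measure_mono_ae ?_
  filter_upwards [hn] with ω hω hωε
  by_contra hnot
  exact ((hω hnot).trans_lt hηε.2).not_ge hωε

theorem supNormOn_le {S : Set ℝ} {g : ℝ → ℝ} {ε : ℝ} (h : ∀ t ∈ S, |g t| ≤ ε) :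
    supNormOn S g ≤ ENNReal.ofReal ε :=
  iSup₂_le fun t ht => by
    rw [← ofReal_norm]
    exact ENNReal.ofReal_le_ofReal (h t ht)

end Consistency

end SingleIndex

theorem mainTheorem6 {Ω : Type*} [MeasurableSpace Ω] (μ : Measure Ω) [IsProbabilityMeasure μ]
    (d : ℕ) [NeZero d]
    (X : ℕ → Ω → EuclideanSpace ℝ (Fin d)) (Y : ℕ → Ω → ℝ)
    (m₀ : ℝ → ℝ) (θ₀ : EuclideanSpace ℝ (Fin d)) (r M₀ : ℝ) (L₀ L : ℝ≥0)
    (hsample : SingleIndex.IsIIDSample μ X Y)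
    (hθ₀ : θ₀ ∈ SingleIndex.Theta d)
    (hident : SingleIndex.Identifiable μ (X 0) θ₀)
    (hsupp : SingleIndex.CompactlySupported μ (X 0))
    (herr : SingleIndex.SubGaussianError μ (X 0) (SingleIndex.modelError (X 0) (Y 0) m₀ θ₀))
    (hinfo : IsUnit (SingleIndex.informationMatrix μ (X 0) m₀ θ₀))
    (hvar : (SingleIndex.varianceMatrix μ (X 0)).PosDef)
    (hr : 0 < r)
    (hm₀ : m₀ ∈ SingleIndex.convexLipschitz
      (SingleIndex.localRange (SingleIndex.covariateSupport μ (X 0)) θ₀ r) L₀)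
    (hM₀ : 1 ≤ M₀)
    (hbdd : ∀ t ∈ SingleIndex.localRange (SingleIndex.covariateSupport μ (X 0)) θ₀ r,
      |m₀ t| ≤ M₀)
    (hL : L₀ ≤ L)
    (mhat : ℕ → Ω → ℝ → ℝ) (θhat : ℕ → Ω → EuclideanSpace ℝ (Fin d))
    (hLLSE : ∀ n, 1 ≤ n → ∀ᵐ ω ∂μ,
      SingleIndex.IsLLSE (SingleIndex.covariateSupport μ (X 0)) L
        (fun i => X i ω) (fun i => Y i ω) n (mhat n ω) (θhat n ω)) :
    SingleIndex.IsLittleOpOne μ (fun n ω => ‖θhat n ω - θ₀‖ₑ) ∧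
    SingleIndex.IsLittleOpOne μ (fun n ω => SingleIndex.supNormOn
      (SingleIndex.indexRange (SingleIndex.covariateSupport μ (X 0)) θ₀)
      (fun t => mhat n ω t - m₀ t)) ∧
    ∀ C : Set ℝ, IsCompact C →
      C ⊆ interior (SingleIndex.indexRange (SingleIndex.covariateSupport μ (X 0)) θ₀) →
      (∀ t ∈ C, DifferentiableAt ℝ m₀ t) →
      SingleIndex.IsLittleOpOne μ (fun n ω => SingleIndex.supNormOn C
        (fun t => SingleIndex.rightDeriv (mhat n ω) t - SingleIndex.rightDeriv m₀ t)) := by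
  have hD₀ : SingleIndex.indexRange (SingleIndex.covariateSupport μ (X 0)) θ₀ ⊆
      SingleIndex.localRange (SingleIndex.covariateSupport μ (X 0)) θ₀ r :=
    subset_biUnion_of_mem (u := SingleIndex.indexRange (SingleIndex.covariateSupport μ (X 0)))
      (show θ₀ ∈ {η ∈ SingleIndex.Theta d | ‖η - θ₀‖ ≤ r} from ⟨hθ₀, by simpa using hr.le⟩)
  have hD : SingleIndex.indexRange (SingleIndex.covariateSupport μ (X 0)) θ₀ ⊆
      SingleIndex.fullRange (SingleIndex.covariateSupport μ (X 0)) :=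
    subset_biUnion_of_mem (u := SingleIndex.indexRange (SingleIndex.covariateSupport μ (X 0))) hθ₀
  have hm₀D : m₀ ∈ SingleIndex.convexLipschitz
      (SingleIndex.indexRange (SingleIndex.covariateSupport μ (X 0)) θ₀) L :=
    ⟨hm₀.1.subset (convexHull_mono hD₀) (convex_convexHull ℝ _),
      (hm₀.2.mono (convexHull_mono hD₀)).weaken hL⟩
  have key := fun {ε : ℝ} (hε : 0 < ε) => SingleIndex.tendsto_measure_estimate_far hsample
    hsupp.1 hθ₀ hident hinfo hm₀D herr hLLSE hε
  refine ⟨?_, ?_, fun C hC hCD hdiff => ?_⟩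
  · refine SingleIndex.isLittleOpOne_of_forall fun ε hε => ⟨_, key hε, .of_forall fun n =>
      ae_of_all _ fun ω hω => ?_⟩
    rw [← ofReal_norm]
    exact ENNReal.ofReal_le_ofReal (not_le.1 fun h => hω (Or.inl h)).le
  · refine SingleIndex.isLittleOpOne_of_forall fun ε hε => ⟨_, key hε, .of_forall fun n =>
      ae_of_all _ fun ω hω => SingleIndex.supNormOn_le fun t ht => ?_⟩
    exact (not_le.1 fun h => hω (Or.inr ⟨t, ht, h⟩)).le
  · refine SingleIndex.isLittleOpOne_of_forall fun ε hε => ?_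
    obtain ⟨δ, hδ, hclose⟩ := SingleIndex.exists_forall_abs_rightDeriv_sub_lt
      (subset_convexHull ℝ _) hm₀D.1 hC hCD hdiff hε
    refine ⟨_, key hδ, ?_⟩
    filter_upwards [eventually_ge_atTop 1] with n hn
    filter_upwards [hLLSE n hn] with ω hω hωfar
    refine SingleIndex.supNormOn_le fun t ht => (hclose _
      (hω.1.1.subset (convexHull_mono hD) (convex_convexHull ℝ _)) (fun u hu => ?_) t ht).le
    exact not_le.1 fun h => hωfar (Or.inr ⟨u, hu, h⟩)
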